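/- Let $k\ge 1$ and $n\ge k$ be integers, and for $j\ge1$ let $\delta_j=(j-1,j-2,\dots,1)$ be the staircase partition. For a partition $\lambda$ with at most $n$ parts let $$G_\lambda(x_1,\dots,x_n\mid\beta)=\sum_T \beta^{|T|-|\lambda|}x^{\omega(T)}$$ be the stable Grothendieck polynomial: $T$ runs over the set-valued tableaux of shape $\lambda$, i.e. the assignments of nonempty sets $T_{i,j}\subseteq\{1,\dots,n\}$ to the boxes of $\lambda$ with $\max T_{i,j}\le\min T_{i,j+1}$ and $\max T_{i,j}<\min T_{i+1,j}$; $|T|=\sum|T_{i,j}|$, and $x^{\omega(T)}=\prod_m x_m^{\omega_m(T)}$ with $\omega_m(T)$ the number of boxes whose set contains $m$. Let $F^{(n)}_\lambda(t)$ be the Holman hypergeometric series $$F^{(n)}_\lambda(t)=\sum_{k_1,\dots,k_n\ge0}\ \prod_{1\le i<j\le n}\frac{A_{ij}+k_i-k_j}{A_{ij}}\ \prod_{i=1}^n\frac{(1-i)_{k_i}}{(1)_{k_i}}\,t^{k_i},\qquad A_{ij}=\lambda_i-\lambda_j+j-i,$$ where $(a)_s=a(a+1)\cdots(a+s-1)$.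 Let $$P_k^{(a,b)}(z)=\sum_{r=0}^k\binom{k+a}{k-r}\binom{k+b}{r}\Bigl(\frac{z-1}2\Bigr)^r\Bigl(\frac{z+1}2\Bigr)^{k-r}$$ be the Jacobi polynomial. Let $\beta$ be an element of a field $K$ of characteristic $0$ (for example a complex number, or the indeterminate of a field of rational functions). Then the series $F^{(n)}_{\delta_k}(-\beta)$ and $F^{(n)}_{\delta_{k+1}}(-\beta)$ have only finitely many nonzero terms; $G_{\delta_k}(1,\dots,1\mid\beta)\ne0$ if $\beta$ is transcendental over $\mathbb Q$ (in particular if $\beta$ is an indeterminate); and whenever $G_{\delta_k}(1,\dots,1\mid\beta)\neq0$, also $F^{(n)}_{\delta_k}(-\beta)\ne0$ and $$\frac{G_{\delta_{k+1}}(1,\dots,1\mid\beta)}{G_{\delta_k}(1,\dots,1\mid\beta)}=\frac{2^{2k}(k!)^2}{(2k)!}\,P_k^{\left(\frac{n-k-1}2,\ \frac{-n-k-1}2\right)}(-1)\cdot\frac{F^{(n)}_{\delta_{k+1}}(-\beta)}{F^{(n)}_{\delta_k}(-\beta)}.$$ -/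

import Mathlib

namespace StaircaseGrothendieck

/-- The staircase partition `δ_k = (k-1, k-2, …, 1)` as a Young diagram. Rows and columns are
numbered from `0`, so that the box `(i, j)` belongs to it iff `j < k - 1 - i`. -/
def staircase (k : ℕ) : YoungDiagram where
  cells := (Finset.range k ×ˢ Finset.range k).filter fun u => u.1 + u.2 + 1 < k
  isLowerSet := by
    rintro ⟨a, b⟩ ⟨c, d⟩ h hab
    obtain ⟨h1, h2⟩ := Prod.mk_le_mk.mp h
    simp only [Finset.coe_filter, Finset.mem_product, Finset.mem_range, Set.mem_setOf_eq] at hab ⊢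
    omega

/-- `T` is a set-valued semistandard tableau of shape `μ` with entries in an `n`-element
alphabet: every box carries a nonempty set, `max T(i,j) ≤ min T(i,j+1)` and
`max T(i,j) < min T(i+1,j)` whenever both boxes lie in the diagram. -/
def IsSetValuedTableau (μ : YoungDiagram) {n : ℕ} (T : μ.cells → Finset (Fin n)) : Prop :=
  (∀ u, (T u).Nonempty) ∧
  (∀ u v : μ.cells, v.1 = (u.1.1, u.1.2 + 1) → ∀ a ∈ T u, ∀ b ∈ T v, a ≤ b) ∧
  (∀ u v : μ.cells, v.1 = (u.1.1 + 1, u.1.2) → ∀ a ∈ T u, ∀ b ∈ T v, a < b)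

open Classical in
/-- The stable Grothendieck polynomial
`G_μ(x₁, …, xₙ | β) = ∑_T β ^ (|T| - |μ|) x ^ ω(T)`, the sum over the set-valued tableaux `T` of
shape `μ`; `|T|` is the total number of entries of `T` (at least `|μ|`) and `ω_m(T)` is the number
of boxes that contain `m`. -/
noncomputable def grothendieck {R : Type*} [CommSemiring R] (μ : YoungDiagram) {n : ℕ}
    (x : Fin n → R) (β : R) : R :=
  ∑ T ∈ (Finset.univ : Finset (μ.cells → Finset (Fin n))).filter (IsSetValuedTableau μ),
    β ^ ((∑ u, (T u).card) - μ.card) *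
      ∏ m : Fin n, x m ^ (Finset.univ.filter fun u => m ∈ T u).card

/-- The generalized binomial coefficient `a (a - 1) ⋯ (a - r + 1) / r!`. -/
noncomputable def binom {K : Type*} [Field K] (a : K) (r : ℕ) : K :=
  (∏ i ∈ Finset.range r, (a - i)) / (r.factorial : K)

/-- The Jacobi polynomial `P_k^{(α, β)}(z)`, for arbitrary parameters, by its finite expansion. -/
noncomputable def jacobi {K : Type*} [Field K] (k : ℕ) (α β z : K) : K :=
  ∑ r ∈ Finset.range (k + 1),
    binom (k + α) (k - r) * binom (k + β) r * ((z - 1) / 2) ^ r * ((z + 1) / 2) ^ (k - r)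

/-- The Pochhammer symbol `(a)_s = a (a + 1) ⋯ (a + s - 1)`. -/
noncomputable def poch {K : Type*} [Field K] (a : K) (s : ℕ) : K :=
  ∏ i ∈ Finset.range s, (a + i)

/-- The term of index `(k₁, …, kₙ)` of the Holman hypergeometric series. Only the entries `A i j`
with `i < j` are used. -/
noncomputable def holmanTerm {K : Type*} [Field K] {n v w : ℕ} (A : Fin n → Fin n → K)
    (a : Fin n → Fin v → K) (b : Fin n → Fin w → K) (z : Fin n → K) (k : Fin n → ℕ) : K :=
  (∏ i : Fin n, ∏ j ∈ Finset.univ.filter (fun j => i < j), (A i j + k i - k j) / A i j) *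
    (∏ j : Fin v, ∏ i : Fin n, poch (a i j) (k i)) *
    (∏ j : Fin w, ∏ i : Fin n, 1 / poch (b i j) (k i)) *
    ∏ i : Fin n, z i ^ k i

/-- The Holman hypergeometric series `F^{(n)}((A_ij) | (a_ij) | (b_ij) | (z_i))`. -/
noncomputable def holman {K : Type*} [Field K] [TopologicalSpace K] {n v w : ℕ}
    (A : Fin n → Fin n → K) (a : Fin n → Fin v → K) (b : Fin n → Fin w → K) (z : Fin n → K) : K :=
  ∑' k : Fin n → ℕ, holmanTerm A a b z k

/-- The entries `A_ij = μ_i - μ_j + j - i`. -/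
def shapeA (K : Type*) [Field K] (n : ℕ) (μ : YoungDiagram) (i j : Fin n) : K :=
  (μ.rowLen i : K) - μ.rowLen j + (j : ℕ) - (i : ℕ)

/-- The column `(0, -1, …, -n + 1)`. -/
def upperParam (K : Type*) [Field K] (n : ℕ) (i : Fin n) (_ : Fin 1) : K := -((i : ℕ) : K)

/-- The column `(1, 1, …, 1)`. -/
def lowerParam (K : Type*) [Field K] (n : ℕ) (_ : Fin n) (_ : Fin 1) : K := 1

/-- The terms of the series `F^{(n)}_μ(t)`. -/
noncomputable def holmanShapeTerm {K : Type*} [Field K] (n : ℕ) (μ : YoungDiagram) (t : K) :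
    (Fin n → ℕ) → K :=
  holmanTerm (shapeA K n μ) (upperParam K n) (lowerParam K n) (fun _ => t)

/-- `F^{(n)}_μ(t)`: the Holman series with `A_ij = μ_i - μ_j + j - i`, upper parameters
`0, -1, …, -n + 1`, lower parameters `1` and all variables equal to `t`. -/
noncomputable def holmanShape {K : Type*} [Field K] [TopologicalSpace K] (n : ℕ)
    (μ : YoungDiagram) (t : K) : K :=
  holman (shapeA K n μ) (upperParam K n) (lowerParam K n) (fun _ => t)

end StaircaseGrothendieck

/-! Write `x = 1 + X`. The quotient of `det (x_i ^ (λ_j + n - 1 - j) (1 + β x_i) ^ j)` by the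
Vandermonde determinant becomes, at `x = (1, …, 1)`, the determinant `coeffDet` of the coefficients
of its row polynomials in `X`. This determinant and `G_λ(1, …, 1)` satisfy the same recursion in
`n`: for tableaux it is the removal of the largest letter (`grothendieckOnes_succ`), for the
determinant a row operation whose result telescopes (`coeffDet_succ`).

Expanding every `(1 + β x) ^ j` binomially turns `coeffDet` into a sum of determinants of binomial
coefficients, each a Vandermonde product divided by `∏ i!` (`det_choose_rev`). The resulting sum is
`∏ A_ij` times the Holman series (`factorial_mul_grothendieck`).

In the quotient for two consecutive staircases the factorials cancel, and what remains besides the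
series is the quotient of the two products `∏ A_ij`. It telescopes to `∏ (k + n - 2i - 1) / ∏ (2k -
2i - 1)` over `i < k` (`prodA_staircase_succ`). The numerator is `2 ^ k k!` times the Jacobi value
at `-1`, where only one term survives (`jacobi_neg_one`), and the denominator is `(2k)! / (2 ^ k
k!)` (`prod_odd_mul`). -/

namespace StaircaseGrothendieck
open Finset

/-! ### Set-valued tableaux as sets of triples -/

/-- `T` is the set of triples `(i, j, m)`, `m` an entry of the box `(i, j)`, of a set-valued
tableau with row lengths `l` and entries in `{0, …, n - 1}`. -/
structure IsEntrySet (n : ℕ) (l : ℕ → ℕ) (T : Finset (ℕ × ℕ × ℕ)) : Prop where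
  lt : ∀ {i j m}, (i, j, m) ∈ T → m < n
  col_lt : ∀ {i j m}, (i, j, m) ∈ T → j < l i
  nonempty : ∀ {i j}, j < l i → ∃ m, (i, j, m) ∈ T
  row : ∀ {i j a b}, (i, j, a) ∈ T → (i, j + 1, b) ∈ T → a ≤ b
  col : ∀ {i j a b}, (i, j, a) ∈ T → (i + 1, j, b) ∈ T → a < b

theorem IsEntrySet.row_le {n : ℕ} {l : ℕ → ℕ} (hl : Antitone l) {T : Finset (ℕ × ℕ × ℕ)}
    (hT : IsEntrySet n l T) {i j m : ℕ} (h : (i, j, m) ∈ T) : i ≤ m := by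
  induction i generalizing m with
  | zero => exact Nat.zero_le _
  | succ i ih =>
    obtain ⟨a, ha⟩ := hT.nonempty ((hT.col_lt h).trans_le (hl (Nat.le_succ i)))
    exact (ih ha).trans_lt (hT.col ha h)

open Classical in
/-- The entry sets of the set-valued tableaux with row lengths `l`. -/
noncomputable def entrySets (n : ℕ) (l : ℕ → ℕ) : Finset (Finset (ℕ × ℕ × ℕ)) :=
  (range n ×ˢ range (l 0) ×ˢ range n).powerset.filter (IsEntrySet n l)

theorem mem_entrySets {n : ℕ} {l : ℕ → ℕ} (hl : Antitone l) {T : Finset (ℕ × ℕ × ℕ)} :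
    T ∈ entrySets n l ↔ IsEntrySet n l T := by
  simp only [entrySets, mem_filter, mem_powerset, and_iff_right_iff_imp]
  rintro hT ⟨i, j, m⟩ h
  simp only [mem_product, mem_range]
  exact ⟨(hT.row_le hl h).trans_lt (hT.lt h), (hT.col_lt h).trans_le (hl (Nat.zero_le i)), hT.lt h⟩

/-- The stable Grothendieck polynomial at `(1, …, 1)` for the shape with row lengths `l`. -/
noncomputable def grothendieckOnes {R : Type*} [CommSemiring R] (β : R) (n : ℕ) (l : ℕ → ℕ) : R :=
  ∑ T ∈ entrySets n l, β ^ (T.card - ∑ i ∈ range n, l i)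

/-- The boxes `(i, j)` with `m i ≤ j < l i`, `i ≤ n`, filled with `n`. -/
def stripEntries (n : ℕ) (l m : ℕ → ℕ) : Finset (ℕ × ℕ × ℕ) :=
  (range (n + 1)).biUnion fun i => (Ico (m i) (l i)).image fun j => (i, j, n)

theorem mem_stripEntries {n : ℕ} {l m : ℕ → ℕ} {i j a : ℕ} :
    (i, j, a) ∈ stripEntries n l m ↔ i ≤ n ∧ m i ≤ j ∧ j < l i ∧ a = n := by
  simp only [stripEntries, mem_biUnion, mem_range, mem_image, mem_Ico, Prod.mk.injEq]
  constructor
  · rintro ⟨i', hi, j', ⟨h1, h2⟩, rfl, rfl, rfl⟩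
    exact ⟨by omega, h1, h2, rfl⟩
  · rintro ⟨h1, h2, h3, rfl⟩
    exact ⟨i, by omega, j, ⟨h2, h3⟩, rfl, rfl, rfl⟩

theorem card_stripEntries (n : ℕ) (l m : ℕ → ℕ) :
    (stripEntries n l m).card = ∑ i ∈ range (n + 1), (l i - m i) := by
  rw [stripEntries, card_biUnion]
  · refine sum_congr rfl fun i _ => ?_
    rw [card_image_of_injective _ (fun _ _ h => by simpa using h), Nat.card_Ico]
  · intro i _ i' _ hne
    rw [Function.onFun, disjoint_left]
    rintro ⟨a, b, c⟩ h h'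
    simp only [mem_image, Prod.mk.injEq] at h h'
    obtain ⟨_, _, rfl, _⟩ := h
    obtain ⟨_, _, rfl, _⟩ := h'
    exact hne rfl

/-- The entries `n` in the last boxes of the rows in `S`. -/
def cornerEntries (n : ℕ) (m : ℕ → ℕ) (S : Finset ℕ) : Finset (ℕ × ℕ × ℕ) :=
  S.image fun i => (i, m i - 1, n)

theorem mem_cornerEntries {n : ℕ} {m : ℕ → ℕ} {S : Finset ℕ} {i j a : ℕ} :
    (i, j, a) ∈ cornerEntries n m S ↔ i ∈ S ∧ j = m i - 1 ∧ a = n := by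
  simp only [cornerEntries, mem_image, Prod.mk.injEq]
  constructor
  · rintro ⟨i', hi, rfl, rfl, rfl⟩
    exact ⟨hi, rfl, rfl⟩
  · rintro ⟨h1, rfl, rfl⟩
    exact ⟨i, h1, rfl, rfl, rfl⟩

theorem card_cornerEntries (n : ℕ) (m : ℕ → ℕ) (S : Finset ℕ) :
    (cornerEntries n m S).card = S.card :=
  card_image_of_injective _ fun _ _ h => (Prod.mk.inj h).1

/-- The rows whose last box may receive the additional entry `n`. -/
def freeRows (n : ℕ) (l m : ℕ → ℕ) : Finset ℕ := (range n).filter fun i => l (i + 1) < m i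

/-! ### Removal of the largest letter and the branching rule -/

section Fibre

variable {n : ℕ} {l m : ℕ → ℕ}

theorem IsEntrySet.restrict {T : Finset (ℕ × ℕ × ℕ)} (hT : IsEntrySet (n + 1) l T)
    (hm : ∀ i j, j < m i ↔ ∃ a < n, (i, j, a) ∈ T) :
    IsEntrySet n m (T.filter fun x => x.2.2 < n) where
  lt h := (mem_filter.1 h).2
  col_lt {i j a} h := (hm i j).2 ⟨a, (mem_filter.1 h).2, (mem_filter.1 h).1⟩
  nonempty {i j} h := by
    obtain ⟨a, ha, h⟩ := (hm i j).1 h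
    exact ⟨a, mem_filter.2 ⟨h, ha⟩⟩
  row h h' := hT.row (mem_filter.1 h).1 (mem_filter.1 h').1
  col h h' := hT.col (mem_filter.1 h).1 (mem_filter.1 h').1

theorem IsEntrySet.mem_glue_iff {T : Finset (ℕ × ℕ × ℕ)} (hT : IsEntrySet n m T)
    {S : Finset ℕ} (i j a : ℕ) :
    (i, j, a) ∈ T ∪ stripEntries n l m ∪ cornerEntries n m S ↔
      (a < n ∧ (i, j, a) ∈ T) ∨ a = n ∧ (i ≤ n ∧ m i ≤ j ∧ j < l i ∨ i ∈ S ∧ j = m i - 1) := by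
  simp only [mem_union, mem_stripEntries, mem_cornerEntries]
  have := @hT.lt i j a
  tauto

theorem IsEntrySet.glue {T : Finset (ℕ × ℕ × ℕ)} (hT : IsEntrySet n m T) (hm : Antitone m)
    (h0 : ∀ i, n < i → l i = 0) (hml : ∀ i, m i ≤ l i) (hlm : ∀ i, l (i + 1) ≤ m i)
    {S : Finset ℕ} (hS : S ⊆ freeRows n l m) :
    IsEntrySet (n + 1) l (T ∪ stripEntries n l m ∪ cornerEntries n m S) := by
  have hS' : ∀ {i}, i ∈ S → i < n ∧ l (i + 1) < m i := fun h => by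
    simpa [freeRows] using hS h
  refine ⟨?_, ?_, ?_, ?_, ?_⟩
  · intro i j a h
    rw [hT.mem_glue_iff] at h
    omega
  · intro i j a h
    rw [hT.mem_glue_iff] at h
    rcases h with ⟨_, h⟩ | ⟨_, ⟨_, _, h⟩ | ⟨h, h'⟩⟩
    · exact (hT.col_lt h).trans_le (hml i)
    · exact h
    · have := hS' h; have := hml i; omega
  · intro i j h
    simp only [hT.mem_glue_iff]
    by_cases hj : j < m i
    · obtain ⟨a, ha⟩ := hT.nonempty hj
      exact ⟨a, .inl ⟨hT.lt ha, ha⟩⟩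
    · refine ⟨n, .inr ⟨rfl, .inl ⟨?_, not_lt.1 hj, h⟩⟩⟩
      by_contra hi
      rw [h0 i (not_le.1 hi)] at h
      omega
  · intro i j a b h h'
    rw [hT.mem_glue_iff] at h h'
    rcases h with ⟨ha, h⟩ | ⟨ha, h⟩ <;> rcases h' with ⟨hb, h'⟩ | ⟨hb, h'⟩
    · exact hT.row h h'
    · omega
    · have := hT.col_lt h'
      rcases h with ⟨_, h, _⟩ | ⟨_, h⟩ <;> omega
    · omega
  · intro i j a b h h'
    rw [hT.mem_glue_iff] at h h'
    rcases h with ⟨ha, h⟩ | ⟨ha, h⟩ <;> rcases h' with ⟨hb, h'⟩ | ⟨hb, h'⟩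
    · exact hT.col h h'
    · omega
    · have := hT.col_lt h'
      have := hml (i + 1); have := hlm i; have := hm (Nat.le_succ i)
      rcases h with ⟨_, h, _⟩ | ⟨h1, h⟩
      · simp only [Nat.succ_eq_add_one] at *; omega
      · have := hS' h1; omega
    · have h3 : j < l (i + 1) := by
        rcases h' with ⟨_, _, h'⟩ | ⟨h1, h'⟩
        · exact h'
        · have := hS' h1; have := hml (i + 1); omega
      have := hlm i
      rcases h with ⟨_, h, _⟩ | ⟨h1, h⟩
      · omega
      · have := hS' h1; omega

theorem IsEntrySet.inner_glue {T : Finset (ℕ × ℕ × ℕ)} (hT : IsEntrySet n m T)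
    {S : Finset ℕ} (i j : ℕ) :
    j < m i ↔ ∃ a < n, (i, j, a) ∈ T ∪ stripEntries n l m ∪ cornerEntries n m S := by
  simp only [hT.mem_glue_iff]
  constructor
  · intro h
    obtain ⟨a, ha⟩ := hT.nonempty h
    exact ⟨a, hT.lt ha, .inl ⟨hT.lt ha, ha⟩⟩
  · rintro ⟨a, ha, ⟨_, h⟩ | h⟩
    · exact hT.col_lt h
    · omega

theorem IsEntrySet.glue_restrict {T : Finset (ℕ × ℕ × ℕ)} (hT : IsEntrySet (n + 1) l T)
    (h0 : ∀ i, n < i → l i = 0) (h0' : ∀ i, n ≤ i → m i = 0)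
    (hlm : ∀ i, l (i + 1) ≤ m i)
    (hm : ∀ i j, j < m i ↔ ∃ a < n, (i, j, a) ∈ T) :
    (T.filter fun x => x.2.2 < n) ∪ stripEntries n l m ∪
      cornerEntries n m ((freeRows n l m).filter fun i => (i, m i - 1, n) ∈ T) = T := by
  ext ⟨i, j, a⟩
  rw [(hT.restrict hm).mem_glue_iff]
  simp only [mem_filter, freeRows, mem_range]
  constructor
  · rintro (⟨_, h, _⟩ | ⟨rfl, ⟨h1, h2, h3⟩ | ⟨⟨⟨h1, h2⟩, h3⟩, rfl⟩⟩)
    · exact h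
    · obtain ⟨b, hb⟩ := hT.nonempty h3
      have := hT.lt hb
      have h4 : ¬ b < a := fun h => by
        have := (hm i j).2 ⟨b, h, hb⟩
        omega
      obtain rfl : b = a := by omega
      exact hb
    · exact h3
  · intro h
    have := hT.lt h
    by_cases ha : a < n
    · exact .inl ⟨ha, h, ha⟩
    obtain rfl : a = n := by omega
    refine .inr ⟨rfl, ?_⟩
    have hjl := hT.col_lt h
    by_cases hj : m i ≤ j
    · refine .inl ⟨?_, hj, hjl⟩
      by_contra hi
      rw [h0 i (not_le.1 hi)] at hjl
      omega
    -- Row monotonicity allows the letter `n` only in the last box of row `i` of the inner shape,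
    -- since the next box would contain a smaller letter.
    have hjm : j = m i - 1 := by
      by_contra hne
      obtain ⟨b, hb, hb'⟩ := (hm i (j + 1)).1 (by omega)
      have := hT.row h hb'
      omega
    subst hjm
    refine .inr ⟨⟨⟨?_, ?_⟩, h⟩, rfl⟩
    · by_contra hi
      have := h0' i (not_lt.1 hi)
      omega
    -- A box of `l` directly below would need a letter larger than `n`.
    · by_contra hlt
      obtain ⟨b, hb⟩ := hT.nonempty (i := i + 1) (j := m i - 1) (by have := hlm i; omega)
      have := hT.lt hb
      have := hT.col h hb
      omega

theorem IsEntrySet.restrict_glue {T : Finset (ℕ × ℕ × ℕ)} (hT : IsEntrySet n m T)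
    (S : Finset ℕ) :
    (T ∪ stripEntries n l m ∪ cornerEntries n m S).filter (fun x => x.2.2 < n) = T := by
  ext ⟨i, j, a⟩
  rw [mem_filter, hT.mem_glue_iff]
  have := @hT.lt i j a
  constructor
  · rintro ⟨⟨_, h⟩ | ⟨h, _⟩, h'⟩
    · exact h
    · simp only at h'; omega
  · exact fun h => ⟨.inl ⟨this h, h⟩, this h⟩

theorem IsEntrySet.corners_glue {T : Finset (ℕ × ℕ × ℕ)} (hT : IsEntrySet n m T)
    {S : Finset ℕ} (hS : S ⊆ freeRows n l m) :
    ((freeRows n l m).filter fun i =>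
      (i, m i - 1, n) ∈ T ∪ stripEntries n l m ∪ cornerEntries n m S) = S := by
  ext i
  simp only [mem_filter, hT.mem_glue_iff, lt_irrefl, false_and, false_or, true_and, and_true]
  constructor
  · rintro ⟨h, ⟨_, h1, _⟩ | h1⟩
    · simp only [freeRows, mem_filter] at h; omega
    · exact h1
  · exact fun h => ⟨hS h, .inr h⟩

theorem IsEntrySet.card_glue {T : Finset (ℕ × ℕ × ℕ)} (hT : IsEntrySet n m T)
    {S : Finset ℕ} (hS : S ⊆ freeRows n l m) :
    (T ∪ stripEntries n l m ∪ cornerEntries n m S).card =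
      T.card + ∑ i ∈ range (n + 1), (l i - m i) + S.card := by
  rw [card_union_of_disjoint, card_union_of_disjoint, card_stripEntries, card_cornerEntries]
  · rw [disjoint_left]
    rintro ⟨i, j, a⟩ h h'
    have := hT.lt h
    rw [mem_stripEntries] at h'
    omega
  · rw [disjoint_left]
    rintro ⟨i, j, a⟩ h h'
    rw [mem_cornerEntries] at h'
    have := hS h'.1
    simp only [freeRows, mem_filter] at this
    rw [mem_union, mem_stripEntries] at h
    rcases h with h | h
    · have := hT.lt h; omega
    · omega

theorem IsEntrySet.sum_le_card {T : Finset (ℕ × ℕ × ℕ)} (hT : IsEntrySet n m T) :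
    ∑ i ∈ range n, m i ≤ T.card := by
  have : (∑ i ∈ range n, m i) = ((range n).sigma fun i => range (m i)).card := by
    simp
  rw [this]
  refine (card_le_card (t := T.image fun x => ⟨x.1, x.2.1⟩) ?_).trans card_image_le
  rintro ⟨i, j⟩ h
  simp only [mem_sigma, mem_range] at h
  obtain ⟨a, ha⟩ := hT.nonempty h.2
  exact mem_image.2 ⟨_, ha, rfl⟩

-- When the letters below `n` occupy exactly the shape `m`, the boxes of `l / m` contain only `n`,
-- and the remaining freedom is the set `S` of free rows whose last inner box also contains `n`.
-- Each such extra entry costs a factor `β`, so the sum over `S` is the expansion of the product of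
-- the `1 + β`.
open Classical in
theorem sum_fibre {R : Type*} [CommRing R] (β : R) (hl : Antitone l) (hm : Antitone m)
    (h0 : ∀ i, n < i → l i = 0) (h0' : ∀ i, n ≤ i → m i = 0)
    (hml : ∀ i, m i ≤ l i) (hlm : ∀ i, l (i + 1) ≤ m i) :
    ∑ T ∈ (entrySets (n + 1) l).filter (fun T => ∀ i j, j < m i ↔ ∃ a < n, (i, j, a) ∈ T),
      β ^ (T.card - ∑ i ∈ range (n + 1), l i) =
    (∏ i ∈ range n, if l (i + 1) < m i then 1 + β else 1) * grothendieckOnes β n m := by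
  rw [← prod_filter, ← freeRows, prod_one_add, grothendieckOnes, sum_mul_sum, ← sum_product']
  symm
  refine sum_nbij' (fun p => p.2 ∪ stripEntries n l m ∪ cornerEntries n m p.1)
    (fun T => ((freeRows n l m).filter fun i => (i, m i - 1, n) ∈ T,
      T.filter fun x => x.2.2 < n)) ?_ ?_ ?_ ?_ ?_
  · rintro ⟨S, T⟩ h
    simp only [mem_product, mem_powerset, mem_entrySets hm] at h
    rw [mem_filter, mem_entrySets hl]
    exact ⟨h.2.glue hm h0 hml hlm h.1, h.2.inner_glue⟩
  · intro T h
    rw [mem_filter, mem_entrySets hl] at h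
    simp only [mem_product, mem_powerset, mem_entrySets hm]
    exact ⟨filter_subset _ _, h.1.restrict h.2⟩
  · rintro ⟨S, T⟩ h
    simp only [mem_product, mem_powerset, mem_entrySets hm] at h
    exact Prod.ext (h.2.corners_glue h.1) (h.2.restrict_glue S)
  · intro T h
    rw [mem_filter, mem_entrySets hl] at h
    exact h.1.glue_restrict h0 h0' hlm h.2
  · rintro ⟨S, T⟩ h
    simp only [mem_product, mem_powerset, mem_entrySets hm] at h
    simp only [prod_const]
    rw [h.2.card_glue h.1, ← pow_add]
    congr 1
    -- The exponents are truncated differences; this bound and `m ≤ l` make them add up.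
    have h1 := h.2.sum_le_card
    have h2 : ∑ i ∈ range (n + 1), (l i - m i) + ∑ i ∈ range (n + 1), m i =
        ∑ i ∈ range (n + 1), l i := by
      rw [← sum_add_distrib]
      exact sum_congr rfl fun i _ => Nat.sub_add_cancel (hml i)
    rw [sum_range_succ m, h0' n le_rfl] at h2
    omega

end Fibre

/-- Extension of a finite sequence by zeros. -/
def extendZero {n : ℕ} (μ : Fin n → ℕ) (i : ℕ) : ℕ := if h : i < n then μ ⟨i, h⟩ else 0

open Classical in
/-- The branching rule for set-valued tableaux. -/
theorem grothendieckOnes_succ {R : Type*} [CommRing R] (β : R) {n : ℕ} {l : ℕ → ℕ}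
    (hl : Antitone l) (h0 : ∀ i, n < i → l i = 0) :
    grothendieckOnes β (n + 1) l =
      ∑ μ ∈ Fintype.piFinset fun i : Fin n => Icc (l (i + 1)) (l i),
        (∏ i : Fin n, if l (i + 1) < μ i then 1 + β else 1) *
          grothendieckOnes β n (extendZero μ) := by
  let P (T : Finset (ℕ × ℕ × ℕ)) (i j : ℕ) : Prop := ∃ a < n, (i, j, a) ∈ T
  have hex : ∀ (T : Finset (ℕ × ℕ × ℕ)) (i : ℕ), IsEntrySet (n + 1) l T → ∃ j, ¬ P T i j :=
    fun T i hT => ⟨l i, fun ⟨a, _, h⟩ => lt_irrefl _ (hT.col_lt h)⟩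
  -- The length of row `i` of the inner shape: the first column whose box has no letter below `n`.
  -- The default `0` is never taken for an entry set.
  let s (T : Finset (ℕ × ℕ × ℕ)) (i : Fin n) : ℕ := if h : ∃ j, ¬ P T i j then Nat.find h else 0
  have hs : ∀ T, IsEntrySet (n + 1) l T → ∀ (i : Fin n) j, j < s T i ↔ P T i j := by
    intro T hT i j
    simp only [s, dif_pos (hex T i hT), Nat.lt_find_iff, not_not]
    -- Boxes with a letter below `n` form an initial segment of the row, because letters weakly
    -- decrease to the left.
    refine ⟨fun h => h j le_rfl, fun h j' hj' => ?_⟩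
    induction hj' using Nat.decreasingInduction with
    | self => exact h
    | of_succ k hk ih =>
      obtain ⟨a, ha, h⟩ := ih
      obtain ⟨b, hb⟩ := hT.nonempty ((Nat.lt_succ_self k).trans (hT.col_lt h))
      exact ⟨b, (hT.row hb h).trans_lt ha, hb⟩
  have hmaps : ∀ T ∈ entrySets (n + 1) l,
      s T ∈ Fintype.piFinset fun i : Fin n => Icc (l (i + 1)) (l i) := by
    intro T hT
    rw [mem_entrySets hl] at hT
    rw [Fintype.mem_piFinset]
    intro i
    rw [mem_Icc]
    constructor
    · by_contra! h
      obtain ⟨b, hb⟩ := hT.nonempty h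
      obtain ⟨a, ha⟩ := hT.nonempty (h.trans_le (hl (Nat.le_succ i)))
      have := hT.lt hb
      have := hT.col ha hb
      exact lt_irrefl _ ((hs T hT i (s T i)).2 ⟨a, by omega, ha⟩)
    · by_contra! h
      obtain ⟨a, _, ha⟩ := (hs T hT i _).1 h
      exact lt_irrefl _ (hT.col_lt ha)
  rw [grothendieckOnes, ← sum_fiberwise_of_maps_to hmaps]
  refine sum_congr rfl fun μ hμ => ?_
  rw [Fintype.mem_piFinset] at hμ
  simp only [mem_Icc] at hμ
  have h0' : ∀ i, n ≤ i → extendZero μ i = 0 := fun i hi => dif_neg (by omega)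
  have hml : ∀ i, extendZero μ i ≤ l i := by
    intro i
    by_cases h : i < n
    · rw [extendZero, dif_pos h]; exact (hμ ⟨i, h⟩).2
    · rw [h0' i (by omega)]; exact Nat.zero_le _
  have hlm : ∀ i, l (i + 1) ≤ extendZero μ i := by
    intro i
    by_cases h : i < n
    · rw [extendZero, dif_pos h]; exact (hμ ⟨i, h⟩).1
    · rw [h0 _ (by omega)]; exact Nat.zero_le _
  have key := sum_fibre β hl (antitone_nat_of_succ_le fun i => (hml _).trans (hlm i)) h0 h0' hml hlm
  rw [← Fin.prod_univ_eq_prod_range (fun i => if l (i + 1) < extendZero μ i then 1 + β else 1)] at key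
  simp only [extendZero, Fin.is_lt, dite_true, Fin.eta] at key
  refine Eq.trans (sum_congr (filter_congr fun T hT => ?_) fun _ _ => rfl) key
  rw [mem_entrySets hl] at hT
  constructor
  · rintro rfl i j
    by_cases h : i < n
    · rw [dif_pos h]; exact hs T hT ⟨i, h⟩ j
    · rw [dif_neg h]
      refine ⟨fun h => absurd h (Nat.not_lt_zero j), ?_⟩
      rintro ⟨a, ha, h'⟩
      have := hT.row_le hl h'
      omega
  · intro h
    funext i
    refine eq_of_forall_lt_iff fun j => ?_
    rw [hs T hT i j]
    have := h i j
    rw [dif_pos i.2] at this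
    exact this.symm

theorem grothendieckOnes_zero {R : Type*} [CommRing R] (β : R) {l : ℕ → ℕ} (hl : l 0 = 0)
    (h : Antitone l) : grothendieckOnes β 0 l = 1 := by
  have : entrySets 0 l = {∅} := by
    ext T
    rw [mem_entrySets h, mem_singleton]
    constructor
    · intro hT
      refine eq_empty_of_forall_notMem fun ⟨i, j, m⟩ hx => ?_
      exact Nat.not_lt_zero _ (hT.lt hx)
    · rintro rfl
      refine ⟨by simp, by simp, fun {i j} hj => ?_, by simp, by simp⟩
      have := h (Nat.zero_le i)
      omega
  simp [grothendieckOnes, this]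

/-! ### Comparison with tableaux as functions on the boxes -/

/-- The entry set of a tableau given as a function on the boxes. -/
def toEntries (μ : YoungDiagram) {n : ℕ} (T : μ.cells → Finset (Fin n)) : Finset (ℕ × ℕ × ℕ) :=
  univ.biUnion fun u => (T u).image fun a : Fin n => (u.1.1, u.1.2, (a : ℕ))

theorem mem_toEntries {μ : YoungDiagram} {n : ℕ} {T : μ.cells → Finset (Fin n)} {i j a : ℕ} :
    (i, j, a) ∈ toEntries μ T ↔ ∃ (h : (i, j) ∈ μ.cells) (h' : a < n), ⟨a, h'⟩ ∈ T ⟨(i, j), h⟩ := by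
  simp only [toEntries, mem_biUnion, mem_univ, true_and, mem_image, Prod.mk.injEq]
  constructor
  · rintro ⟨⟨⟨i', j'⟩, hu⟩, b, hb, rfl, rfl, rfl⟩
    exact ⟨hu, b.2, hb⟩
  · rintro ⟨h, h', hT⟩
    exact ⟨_, _, hT, rfl, rfl, rfl⟩

theorem card_toEntries (μ : YoungDiagram) {n : ℕ} (T : μ.cells → Finset (Fin n)) :
    (toEntries μ T).card = ∑ u, (T u).card := by
  rw [toEntries, card_biUnion]
  · refine sum_congr rfl fun u _ => card_image_of_injective _ fun a b h => ?_
    simpa [Fin.ext_iff] using h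
  · intro u _ v _ hne
    rw [Function.onFun, disjoint_left]
    rintro ⟨a, b, c⟩ h h'
    simp only [mem_image, Prod.mk.injEq] at h h'
    obtain ⟨_, _, rfl, rfl, _⟩ := h
    obtain ⟨_, _, h1, h2, _⟩ := h'
    exact hne (Subtype.ext (Prod.ext h1.symm h2.symm))

theorem card_eq_sum_rowLen (μ : YoungDiagram) {n : ℕ} (hμ : μ.rowLen n = 0) :
    μ.card = ∑ i ∈ range n, μ.rowLen i := by
  rw [YoungDiagram.card, card_eq_sum_card_fiberwise (f := Prod.fst) (t := range n)]
  · refine sum_congr rfl fun i _ => ?_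
    rw [YoungDiagram.rowLen_eq_card]
    rfl
  · rintro ⟨i, j⟩ h
    have h1 : j < μ.rowLen i := YoungDiagram.mem_iff_lt_rowLen.1 h
    simp only [coe_range, Set.mem_Iio]
    by_contra! hi
    have := μ.rowLen_anti n i hi
    omega

theorem isEntrySet_toEntries_iff {μ : YoungDiagram} {n : ℕ} {T : μ.cells → Finset (Fin n)} :
    IsEntrySet n μ.rowLen (toEntries μ T) ↔ IsSetValuedTableau μ T := by
  have hc : ∀ {i j}, (i, j) ∈ μ.cells ↔ j < μ.rowLen i := YoungDiagram.mem_iff_lt_rowLen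
  constructor
  · intro h
    refine ⟨?_, ?_, ?_⟩
    · rintro ⟨⟨i, j⟩, hu⟩
      obtain ⟨m, hm⟩ := h.nonempty (hc.1 hu)
      obtain ⟨_, h', hm⟩ := mem_toEntries.1 hm
      exact ⟨_, hm⟩
    · rintro ⟨⟨i, j⟩, hu⟩ ⟨⟨i', j'⟩, hv⟩ huv a ha b hb
      obtain ⟨rfl, rfl⟩ := Prod.mk.inj huv
      exact h.row (mem_toEntries.2 ⟨hu, a.2, ha⟩) (mem_toEntries.2 ⟨hv, b.2, hb⟩)
    · rintro ⟨⟨i, j⟩, hu⟩ ⟨⟨i', j'⟩, hv⟩ huv a ha b hb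
      obtain ⟨rfl, rfl⟩ := Prod.mk.inj huv
      exact h.col (mem_toEntries.2 ⟨hu, a.2, ha⟩) (mem_toEntries.2 ⟨hv, b.2, hb⟩)
  · rintro ⟨h1, h2, h3⟩
    refine ⟨?_, ?_, ?_, ?_, ?_⟩
    · intro i j m h
      obtain ⟨_, h', _⟩ := mem_toEntries.1 h
      exact h'
    · intro i j m h
      obtain ⟨h', _⟩ := mem_toEntries.1 h
      exact hc.1 h'
    · intro i j h
      obtain ⟨m, hm⟩ := h1 ⟨(i, j), hc.2 h⟩
      exact ⟨m, mem_toEntries.2 ⟨_, m.2, hm⟩⟩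
    · intro i j a b h h'
      obtain ⟨_, _, h⟩ := mem_toEntries.1 h
      obtain ⟨_, _, h'⟩ := mem_toEntries.1 h'
      exact h2 _ _ rfl _ h _ h'
    · intro i j a b h h'
      obtain ⟨_, _, h⟩ := mem_toEntries.1 h
      obtain ⟨_, _, h'⟩ := mem_toEntries.1 h'
      exact h3 _ _ rfl _ h _ h'

open Classical in
theorem grothendieck_one {R : Type*} [CommRing R] (β : R) (μ : YoungDiagram) {n : ℕ}
    (hμ : μ.rowLen n = 0) :
    grothendieck μ (fun _ : Fin n => (1 : R)) β = grothendieckOnes β n μ.rowLen := by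
  have hanti : Antitone μ.rowLen := fun a b h => μ.rowLen_anti a b h
  simp only [grothendieck, one_pow, prod_const_one, mul_one, grothendieckOnes]
  refine sum_nbij (toEntries μ) ?_ ?_ ?_ ?_
  · intro T hT
    rw [mem_entrySets hanti, isEntrySet_toEntries_iff]
    exact (mem_filter.1 hT).2
  · intro T _ T' _ h
    funext u
    ext a
    have := Finset.ext_iff.1 h (u.1.1, u.1.2, (a : ℕ))
    simpa [mem_toEntries] using this
  · intro S hS
    rw [mem_coe, mem_entrySets hanti] at hS
    have : toEntries μ (fun u => univ.filter fun a : Fin n => (u.1.1, u.1.2, (a : ℕ)) ∈ S) = S := by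
      ext ⟨i, j, a⟩
      simp only [mem_toEntries, mem_filter, mem_univ, true_and, exists_prop]
      exact ⟨fun h => h.2.2, fun h => ⟨YoungDiagram.mem_iff_lt_rowLen.2 (hS.col_lt h), hS.lt h, h⟩⟩
    refine ⟨_, ?_, this⟩
    rw [mem_coe, mem_filter, ← isEntrySet_toEntries_iff, this]
    exact ⟨mem_univ _, hS⟩
  · intro T _
    rw [card_toEntries, card_eq_sum_rowLen μ hμ]

end StaircaseGrothendieck

namespace StaircaseGrothendieck
open Finset Polynomial

/-! ### The determinant formula at `x = (1, …, 1)` -/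

section Determinant

variable {R : Type*} [CommRing R]

/-- The polynomial `x ^ (a + n - 1 - j) (1 + β x) ^ j` in the variable `x - 1`. -/
noncomputable def rowPoly (β : R) (n j a : ℕ) : R[X] :=
  (1 + X) ^ (a + (n - 1 - j)) * (1 + C β * (1 + X)) ^ j

/-- The determinant of the coefficients of the polynomials `rowPoly`, the limit at `x = (1, …, 1)`
of the quotient of `det (x_i ^ (l_j + n - 1 - j) (1 + β x_i) ^ j)` by the Vandermonde determinant. -/
noncomputable def coeffDet (β : R) (n : ℕ) (l : ℕ → ℕ) : R :=
  (Matrix.of fun j i : Fin n => (rowPoly β n j (l j)).coeff (i.rev : ℕ)).det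

/-- The terms with weight `1 + β` telescope; the term `m = a`, of weight `1`, absorbs the boundary
contribution `x ^ a (1 + β x)`. -/
theorem telescope_sum (β : R) {a b : ℕ} (h : a ≤ b) (x : R) :
    (1 + β) * x ^ (b + 1) - x ^ a * (1 + β * x) =
      (x - 1) * ∑ m ∈ Icc a b, (if a < m then 1 + β else 1) * x ^ m := by
  induction b, h using Nat.le_induction with
  | base => simp; ring
  | succ b hb ih =>
    rw [sum_Icc_succ_top (by omega), mul_add (x - 1), ← ih, if_pos (by omega)]
    ring

/-- After the common factor `x ^ (n - 1 - j) (1 + β x) ^ j` is taken out, this is `telescope_sum`.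
The weights on the right are those of the branching rule. -/
theorem rowPoly_sub (β : R) {n j a b : ℕ} (hj : j < n) (h : a ≤ b) :
    C (1 + β) * rowPoly β (n + 1) j b - rowPoly β (n + 1) (j + 1) a =
      X * ∑ m ∈ Icc a b, C (if a < m then 1 + β else 1) * rowPoly β n j m := by
  have key := telescope_sum (C β) h (1 + X)
  obtain ⟨d, rfl⟩ : ∃ d, n = j + 1 + d := ⟨n - (j + 1), by omega⟩
  simp only [rowPoly, show j + 1 + d + 1 - 1 - j = d + 1 by omega,
    show j + 1 + d + 1 - 1 - (j + 1) = d by omega, show j + 1 + d - 1 - j = d by omega]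
  have h1 : (1 + X : R[X]) - 1 = X := by ring
  rw [h1] at key
  calc _ = (C (1 + β) * (1 + X) ^ (b + 1) - (1 + X) ^ a * (1 + C β * (1 + X))) *
        ((1 + X) ^ d * (1 + C β * (1 + X)) ^ j) := by ring
    _ = _ := by
      rw [C_add, C_1, key, mul_assoc, sum_mul]
      congr 1
      refine sum_congr rfl fun m _ => ?_
      split_ifs
      · rw [C_add, C_1]; ring
      · rw [C_1]; ring

/-- The bidiagonal matrix of the row operations. -/
def bidiagonal (β : R) (n : ℕ) : Matrix (Fin (n + 1)) (Fin (n + 1)) R :=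
  Matrix.of fun j k => (if k = j then (if j = Fin.last n then 1 else 1 + β) else 0) -
    if (k : ℕ) = j + 1 then 1 else 0

theorem det_bidiagonal (β : R) (n : ℕ) : (bidiagonal β n).det = (1 + β) ^ n := by
  rw [Matrix.det_of_isUpperTriangular, Fin.prod_univ_castSucc]
  · simp [bidiagonal, Fin.castSucc_ne_last]
  · intro j k h
    have h : k < j := h
    have h1 : (k : ℕ) ≠ j + 1 := by have := Fin.lt_def.1 h; omega
    simp [bidiagonal, h.ne, h1]

theorem bidiagonal_mul_castSucc (β : R) (n : ℕ) (M : Matrix (Fin (n + 1)) (Fin (n + 1)) R)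
    (j : Fin n) (i : Fin (n + 1)) :
    (bidiagonal β n * M) j.castSucc i = (1 + β) * M j.castSucc i - M j.succ i := by
  have : ∀ k : Fin (n + 1), (k : ℕ) = (j.castSucc : ℕ) + 1 ↔ k = j.succ := by
    intro k; simp [Fin.ext_iff]
  simp only [Matrix.mul_apply, bidiagonal, Matrix.of_apply, this]
  simp [sub_mul, Fin.castSucc_ne_last]

theorem bidiagonal_mul_last (β : R) (n : ℕ) (M : Matrix (Fin (n + 1)) (Fin (n + 1)) R)
    (i : Fin (n + 1)) : (bidiagonal β n * M) (Fin.last n) i = M (Fin.last n) i := by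
  have : ∀ k : Fin (n + 1), ¬ (k : ℕ) = ((Fin.last n : Fin (n + 1)) : ℕ) + 1 := by
    intro k; have := k.2; simp; omega
  simp only [Matrix.mul_apply, bidiagonal, Matrix.of_apply, this]
  simp

/-- Multiplication by `bidiagonal` replaces each row but the last by the combination in
`rowPoly_sub`, which is divisible by `X`. The factor `(1 + β) ^ n` is its determinant on the left
and the surviving corner entry on the right; it is kept because it need not be cancellable. -/
theorem coeffDet_succ (β : R) {n : ℕ} {l : ℕ → ℕ} (hl : Antitone l) :
    (1 + β) ^ n * coeffDet β (n + 1) l =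
      (1 + β) ^ n * ∑ μ ∈ Fintype.piFinset fun i : Fin n => Icc (l (i + 1)) (l i),
        (∏ i : Fin n, if l (i + 1) < μ i then 1 + β else 1) * coeffDet β n (extendZero μ) := by
  set M : Matrix (Fin (n + 1)) (Fin (n + 1)) R :=
    Matrix.of fun j i => (rowPoly β (n + 1) j (l j)).coeff (i.rev : ℕ) with hM
  set g : Fin n → ℕ → Fin n → R := fun j m i =>
    (if l (j + 1) < m then 1 + β else 1) * (rowPoly β n j m).coeff (i.rev : ℕ) with hg
  have hrow : ∀ (j : Fin n) i, (bidiagonal β n * M) j.castSucc i =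
      (X * ∑ m ∈ Icc (l (j + 1)) (l j),
        C (if l (j + 1) < m then 1 + β else 1) * rowPoly β n j m).coeff (i.rev : ℕ) := by
    intro j i
    rw [bidiagonal_mul_castSucc, ← rowPoly_sub β j.2 (hl (Nat.le_succ j)), coeff_sub, coeff_C_mul]
    simp [hM]
  have h1 : (1 + β) ^ n * coeffDet β (n + 1) l = (bidiagonal β n * M).det := by
    rw [Matrix.det_mul, det_bidiagonal, coeffDet]
  -- With the columns reversed, the last one holds the constant coefficients, which vanish in all
  -- rows but the last.
  rw [h1, Matrix.det_succ_column _ (Fin.last n), Fin.sum_univ_castSucc, sum_eq_zero, zero_add]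
  · have h2 : (bidiagonal β n * M) (Fin.last n) (Fin.last n) = (1 + β) ^ n := by
      rw [bidiagonal_mul_last]
      simp [hM, rowPoly, coeff_zero_eq_eval_zero]
    rw [h2, Even.neg_one_pow ⟨_, rfl⟩, one_mul]
    congr 1
    have h3 : (bidiagonal β n * M).submatrix (Fin.last n).succAbove (Fin.last n).succAbove =
        fun j : Fin n => ∑ m ∈ Icc (l (j + 1)) (l j), g j m := by
      funext j i
      simp only [Matrix.submatrix_apply, Fin.succAbove_last, hrow, Fin.rev_castSucc, Fin.val_succ,
        coeff_X_mul, finsetSum_coeff, coeff_C_mul, hg, Finset.sum_apply]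
    rw [h3]
    -- Every row is a sum over an interval; multilinearity yields one determinant for each
    -- interlacing `μ`.
    refine (MultilinearMap.map_sum_finset Matrix.detRowAlternating.toMultilinearMap g _).trans ?_
    refine sum_congr rfl fun μ _ => ?_
    have h4 := Matrix.det_mul_column (fun j : Fin n => if l (j + 1) < μ j then 1 + β else 1)
      (Matrix.of fun j i : Fin n => (rowPoly β n j (μ j)).coeff (i.rev : ℕ))
    refine h4.trans ?_
    simp [coeffDet, extendZero]
  · intro j _
    rw [hrow]
    simp

theorem coeffDet_zero (β : R) (l : ℕ → ℕ) : coeffDet β 0 l = 1 := by simp [coeffDet]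

theorem grothendieckOnes_eq_coeffDet_of_ne [IsDomain R] {β : R} (hβ : 1 + β ≠ 0) (n : ℕ) {l : ℕ → ℕ}
    (hl : Antitone l) (h0 : ∀ i, n ≤ i → l i = 0) :
    grothendieckOnes β n l = coeffDet β n l := by
  induction n generalizing l with
  | zero => rw [coeffDet_zero, grothendieckOnes_zero β (h0 0 le_rfl) hl]
  | succ n ih =>
    refine mul_left_cancel₀ (pow_ne_zero n hβ) ?_
    rw [coeffDet_succ β hl, grothendieckOnes_succ β hl fun i hi => h0 i hi]
    congr 1
    refine sum_congr rfl fun μ hμ => ?_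
    rw [Fintype.mem_piFinset] at hμ
    simp only [mem_Icc] at hμ
    have hz : ∀ i, n ≤ i → extendZero μ i = 0 := fun i hi => dif_neg (by omega)
    rw [ih (antitone_nat_of_succ_le fun i => ?_) hz]
    by_cases h : i + 1 < n
    · rw [extendZero, extendZero, dif_pos h, dif_pos (by omega)]
      exact (hμ ⟨i + 1, h⟩).2.trans (hμ ⟨i, by omega⟩).1
    · rw [hz _ (by omega)]
      exact Nat.zero_le _

theorem map_grothendieckOnes {S : Type*} [CommRing S] (f : R →+* S) (β : R) (n : ℕ) (l : ℕ → ℕ) :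
    f (grothendieckOnes β n l) = grothendieckOnes (f β) n l := by
  simp [grothendieckOnes]

theorem map_coeffDet {S : Type*} [CommRing S] (f : R →+* S) (β : R) (n : ℕ) (l : ℕ → ℕ) :
    f (coeffDet β n l) = coeffDet (f β) n l := by
  rw [coeffDet, RingHom.map_det, coeffDet]
  congr 1
  ext j i
  simp [← coeff_map, rowPoly, Polynomial.map_mul, Polynomial.map_pow]

/-- Both sides are polynomials in `β`. The case of the indeterminate `X`, where `1 + X ≠ 0`,
specializes to every `β`, including `-1`. -/
theorem grothendieckOnes_eq_coeffDet [IsDomain R] (β : R) (n : ℕ) {l : ℕ → ℕ}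
    (hl : Antitone l) (h0 : ∀ i, n ≤ i → l i = 0) :
    grothendieckOnes β n l = coeffDet β n l := by
  have hX : (1 + X : R[X]) ≠ 0 := fun h => by
    have := congrArg (fun p : R[X] => p.coeff 1) h
    simp [coeff_one] at this
  have := congrArg (evalRingHom β) (grothendieckOnes_eq_coeffDet_of_ne hX n hl h0)
  rwa [map_grothendieckOnes, map_coeffDet, coe_evalRingHom, eval_X] at this

theorem rowPoly_eq_sum (β : R) (n j a : ℕ) :
    rowPoly β n j a =
      ∑ r ∈ range (j + 1), C (j.choose r * β ^ r) * (1 + X) ^ (a + (n - 1 - j) + r) := by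
  rw [rowPoly, add_comm 1 (C β * _), add_pow (C β * _), mul_sum]
  refine sum_congr rfl fun r _ => ?_
  simp only [one_pow, mul_one, mul_pow, C_mul, C_pow, pow_add, C_eq_natCast]
  ring

/-! ### Binomial determinants and the Vandermonde product -/

/-- Expansion of the determinant into binomial determinants. -/
theorem coeffDet_eq_sum (β : R) (n : ℕ) (l : ℕ → ℕ) :
    coeffDet β n l = ∑ κ ∈ Fintype.piFinset fun j : Fin n => range (j + 1),
      (∏ j : Fin n, ((j : ℕ).choose (κ j) : R) * β ^ κ j) *
        (Matrix.of fun j i : Fin n =>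
          ((l j + (n - 1 - j) + κ j).choose (i.rev : ℕ) : R)).det := by
  set g : Fin n → ℕ → Fin n → R := fun j r i => (((j : ℕ).choose r : R) * β ^ r) *
    ((l j + (n - 1 - j) + r).choose (i.rev : ℕ) : R) with hg
  have h3 : (Matrix.of fun j i : Fin n => (rowPoly β n j (l j)).coeff (i.rev : ℕ)) =
      fun j : Fin n => ∑ r ∈ range (j + 1), g j r := by
    funext j i
    simp only [Matrix.of_apply, rowPoly_eq_sum, finsetSum_coeff, coeff_C_mul, Finset.sum_apply, hg,
      coeff_one_add_X_pow]
  rw [coeffDet, h3]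
  refine (MultilinearMap.map_sum_finset Matrix.detRowAlternating.toMultilinearMap g _).trans ?_
  refine sum_congr rfl fun κ _ => ?_
  exact Matrix.det_mul_column (fun j : Fin n => ((j : ℕ).choose (κ j) : R) * β ^ κ j)
    (Matrix.of fun j i : Fin n => ((l j + (n - 1 - j) + κ j).choose (i.rev : ℕ) : R))

theorem prod_pairs_rev {n : ℕ} (f : Fin n → Fin n → R) :
    ∏ i, ∏ j ∈ univ.filter (fun j => i < j), f (Fin.rev i) (Fin.rev j) =
      ∏ i, ∏ j ∈ univ.filter (fun j => i < j), f j i := by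
  simp only [prod_filter]
  rw [prod_comm, ← Equiv.prod_comp Fin.revPerm]
  refine prod_congr rfl fun i _ => ?_
  rw [← Equiv.prod_comp Fin.revPerm]
  simp [Fin.rev_lt_rev]

/-- The factorials turn binomial coefficients into falling factorials, which are monic polynomials
of each degree below `n`, so the determinant is that of Vandermonde. -/
theorem det_choose_rev {n : ℕ} (v : Fin n → ℕ) :
    (∏ i : Fin n, ((i : ℕ).factorial : R)) *
      (Matrix.of fun j i : Fin n => ((v j).choose (i.rev : ℕ) : R)).det =
    ∏ i, ∏ j ∈ univ.filter (fun j => i < j), ((v i : R) - v j) := by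
  suffices H : (∏ i : Fin n, ((i : ℕ).factorial : ℤ)) *
      (Matrix.of fun j i : Fin n => ((v j).choose (i.rev : ℕ) : ℤ)).det =
      ∏ i, ∏ j ∈ univ.filter (fun j => i < j), ((v i : ℤ) - v j) by
    have := congrArg (Int.castRingHom R) H
    simp only [map_mul, map_prod, RingHom.map_det, map_sub, map_natCast] at this
    rw [← this]
    congr 2
    ext; simp
  have h := Matrix.det_eval_matrixOfPolynomials_eq_det_vandermonde
    (fun i => ((v i.rev : ℕ) : ℤ)) (fun i => descPochhammer ℤ i)
    (fun i => descPochhammer_natDegree ℤ i) (fun i => monic_descPochhammer ℤ i)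
  rw [Matrix.det_vandermonde] at h
  -- Rows and columns are reversed together, so no sign appears.
  rw [← Matrix.det_submatrix_equiv_self Fin.revPerm]
  refine Eq.trans ?_ (h.symm.trans ?_)
  · rw [← Matrix.det_mul_row]
    congr 1
    ext i j
    simp [-Fin.val_rev, descPochhammer_eval_eq_descFactorial, Nat.descFactorial_eq_factorial_mul_choose]
  · have := prod_pairs_rev fun i j : Fin n => (v j : ℤ) - v i
    simpa only [filter_lt_eq_Ioi] using this

end Determinant

end StaircaseGrothendieck

namespace StaircaseGrothendieck
open Finset

/-! ### The Holman series as the expanded determinant -/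

section Holman

variable {K : Type*} [Field K]

theorem poch_one (r : ℕ) : poch (1 : K) r = (r.factorial : K) := by
  rw [poch, ← prod_range_add_one_eq_factorial]
  push_cast
  exact prod_congr rfl fun i _ => add_comm _ _

/-- This terminates the series, since the binomial coefficient vanishes for `r > i`; the sign is
cancelled by that of the argument `-β`. -/
theorem poch_neg_natCast (i r : ℕ) :
    poch (-(i : K)) r = (-1) ^ r * (r.factorial : K) * (i.choose r : K) := by
  have h1 : (r.factorial : K) * (i.choose r : K) = ∏ a ∈ range r, ((i : K) - a) := by
    rw [← Nat.cast_mul, ← Nat.descFactorial_eq_factorial_mul_choose,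
      ← descPochhammer_eval_eq_descFactorial, descPochhammer_eval_eq_prod_range]
  rw [mul_assoc, h1, poch, ← card_range r, ← prod_const, card_range, ← prod_mul_distrib]
  exact prod_congr rfl fun a _ => by ring

/-- The product of the `A_ij` over `i < j`. -/
noncomputable def prodA (K : Type*) [Field K] (n : ℕ) (μ : YoungDiagram) : K :=
  ∏ i : Fin n, ∏ j ∈ univ.filter (fun j => i < j), shapeA K n μ i j

variable [CharZero K]

theorem shapeA_ne_zero {n : ℕ} (μ : YoungDiagram) {i j : Fin n} (h : i < j) :
    shapeA K n μ i j ≠ 0 := by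
  have h1 := μ.rowLen_anti i j (Fin.lt_def.1 h).le
  have h2 : shapeA K n μ i j = ((μ.rowLen i - μ.rowLen j + (j - i) : ℕ) : K) := by
    rw [Nat.cast_add, Nat.cast_sub h1, Nat.cast_sub (Fin.lt_def.1 h).le, shapeA]
    ring
  rw [h2, Nat.cast_ne_zero]
  have := Fin.lt_def.1 h
  omega

theorem prodA_ne_zero (n : ℕ) (μ : YoungDiagram) : prodA K n μ ≠ 0 :=
  prod_ne_zero_iff.2 fun _ _ => prod_ne_zero_iff.2 fun _ h =>
    shapeA_ne_zero μ (mem_filter.1 h).2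

theorem prodA_mul_holmanShapeTerm (n : ℕ) (μ : YoungDiagram) (β : K) (κ : Fin n → ℕ) :
    prodA K n μ * holmanShapeTerm n μ (-β) κ =
      (∏ j : Fin n, ((j : ℕ).choose (κ j) : K) * β ^ κ j) *
        ∏ i, ∏ j ∈ univ.filter (fun j => i < j), (shapeA K n μ i j + κ i - κ j) := by
  have h1 : prodA K n μ * ∏ i : Fin n, ∏ j ∈ univ.filter (fun j => i < j),
      (shapeA K n μ i j + κ i - κ j) / shapeA K n μ i j =
      ∏ i, ∏ j ∈ univ.filter (fun j => i < j), (shapeA K n μ i j + κ i - κ j) := by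
    rw [prodA, ← prod_mul_distrib]
    refine prod_congr rfl fun i _ => ?_
    rw [← prod_mul_distrib]
    exact prod_congr rfl fun j hj => mul_div_cancel₀ _ (shapeA_ne_zero μ (mem_filter.1 hj).2)
  rw [← h1, holmanShapeTerm, holmanTerm]
  simp only [univ_unique, prod_singleton, upperParam, lowerParam]
  rw [mul_assoc, mul_assoc, ← mul_assoc (prodA K n μ), mul_comm]
  congr 1
  rw [← prod_mul_distrib, ← prod_mul_distrib]
  refine prod_congr rfl fun i _ => ?_
  have h2 : ((κ i).factorial : K) ≠ 0 := Nat.cast_ne_zero.2 (Nat.factorial_ne_zero _)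
  have h3 : ((-1 : K) ^ κ i) * (-1) ^ κ i = 1 := by rw [← mul_pow]; simp
  rw [poch_one, poch_neg_natCast, neg_pow β]
  field_simp
  linear_combination ((i : ℕ).choose (κ i) : K) * β ^ κ i * h3

theorem holmanShapeTerm_eq_zero {n : ℕ} (μ : YoungDiagram) (β : K) {κ : Fin n → ℕ}
    (h : κ ∉ Fintype.piFinset fun j : Fin n => range (j + 1)) :
    holmanShapeTerm n μ (-β) κ = 0 := by
  rw [Fintype.mem_piFinset, not_forall] at h
  obtain ⟨j, hj⟩ := h
  rw [mem_range, not_lt] at hj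
  refine (mul_eq_zero.1 ?_).resolve_left (prodA_ne_zero (K := K) n μ)
  rw [prodA_mul_holmanShapeTerm, prod_eq_zero (mem_univ j), zero_mul]
  rw [Nat.choose_eq_zero_of_lt hj, Nat.cast_zero, zero_mul]

theorem finite_support_holmanShapeTerm (n : ℕ) (μ : YoungDiagram) (β : K) :
    (Function.support (holmanShapeTerm n μ (-β))).Finite :=
  (Finset.finite_toSet (Fintype.piFinset fun j : Fin n => range (j + 1))).subset fun _ h => by
    by_contra hn
    exact h (holmanShapeTerm_eq_zero μ β hn)

/-- The value of a stable Grothendieck polynomial at `(1, …, 1)` as a Holman series. -/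
theorem factorial_mul_grothendieck [TopologicalSpace K] [T2Space K] (n : ℕ) (μ : YoungDiagram)
    (hμ : μ.rowLen n = 0) (β : K) :
    (∏ i : Fin n, ((i : ℕ).factorial : K)) * grothendieck μ (fun _ : Fin n => (1 : K)) β =
      prodA K n μ * holmanShape n μ (-β) := by
  have hanti : Antitone μ.rowLen := fun a b h => μ.rowLen_anti a b h
  have h0 : ∀ i, n ≤ i → μ.rowLen i = 0 := fun i hi =>
    Nat.eq_zero_of_le_zero ((hanti hi).trans hμ.le)
  rw [grothendieck_one β μ hμ, grothendieckOnes_eq_coeffDet β n hanti h0, coeffDet_eq_sum,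
    holmanShape, holman, ← holmanShapeTerm,
    tsum_eq_sum fun κ hκ => holmanShapeTerm_eq_zero μ β hκ, mul_sum, mul_sum]
  refine sum_congr rfl fun κ _ => ?_
  refine Eq.trans ?_ (prodA_mul_holmanShapeTerm n μ β κ).symm
  -- The nodes `λ_j + n - 1 - j + κ_j` have differences `A_ij + κ_i - κ_j`.
  rw [mul_left_comm, det_choose_rev fun j : Fin n => μ.rowLen j + (n - 1 - j) + κ j]
  congr 1
  refine prod_congr rfl fun i _ => prod_congr rfl fun j _ => ?_
  have hc : ∀ i : Fin n, ((n - 1 - i : ℕ) : K) = (n : K) - 1 - (i : ℕ) := fun i => by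
    have := i.2
    rw [Nat.cast_sub (by omega), Nat.cast_sub (by omega), Nat.cast_one]
  rw [shapeA]
  push_cast [hc]
  ring

end Holman

/-! ### Consecutive staircases and the Jacobi value -/

section Staircase

theorem rowLen_staircase (k i : ℕ) : (staircase k).rowLen i = k - 1 - i := by
  refine eq_of_forall_lt_iff fun j => ?_
  rw [← YoungDiagram.mem_iff_lt_rowLen, ← YoungDiagram.mem_cells]
  simp only [staircase, mem_filter, mem_product, mem_range]
  omega

theorem prod_pairs_eq_prod_range {M : Type*} [CommMonoid M] (n : ℕ) (f : ℕ → ℕ → M) :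
    ∏ i : Fin n, ∏ j ∈ univ.filter (fun j => i < j), f i j =
      ∏ i ∈ range n, ∏ j ∈ Ico (i + 1) n, f i j := by
  rw [← Fin.prod_univ_eq_prod_range (fun i => ∏ j ∈ Ico (i + 1) n, f i j)]
  refine prod_congr rfl fun i _ => ?_
  refine prod_nbij (fun j => (j : ℕ)) ?_ ?_ ?_ fun _ _ => rfl
  · intro j hj
    have := Fin.lt_def.1 (mem_filter.1 hj).2
    have := j.2
    rw [mem_Ico]; omega
  · exact fun _ _ _ _ h => Fin.ext h
  · intro j hj
    rw [coe_Ico, Set.mem_Ico] at hj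
    exact ⟨⟨j, hj.2⟩, mem_filter.2 ⟨mem_univ _, hj.1⟩, rfl⟩

theorem prod_Ico_shift_mul {M : Type*} [CommMonoid M] (f : ℕ → M) {a b : ℕ} (h : a ≤ b) :
    (∏ j ∈ Ico a b, f (j + 1)) * f a = (∏ j ∈ Ico a b, f j) * f b := by
  induction b, h using Nat.le_induction with
  | base => simp
  | succ b hb ih =>
    rw [prod_Ico_succ_top hb, prod_Ico_succ_top hb, mul_right_comm, ih]

variable {K : Type*} [Field K]

/-- From `δ_k` to `δ_{k+1}` the rows `i < k` grow by one and the others stay empty, so `A_ij`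
changes only for `i < k ≤ j`. There it is `k + j - 2i - 1`, and the change is the shift of `j` to `j
+ 1`; the product over `j` telescopes to its end factors at `j = k` and `j = n`. -/
theorem prodA_staircase_succ {k n : ℕ} (hkn : k ≤ n) :
    prodA K n (staircase (k + 1)) * ∏ i ∈ range k, ((k : K) + k - 2 * i - 1) =
      prodA K n (staircase k) * ∏ i ∈ range k, ((k : K) + n - 2 * i - 1) := by
  have hA : ∀ k, prodA K n (staircase k) = ∏ i ∈ range n, ∏ j ∈ Ico (i + 1) n,
      (((k - 1 - i : ℕ) : K) - ((k - 1 - j : ℕ) : K) + j - i) := by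
    intro k
    rw [← prod_pairs_eq_prod_range]
    simp only [prodA, shapeA, rowLen_staircase]
  rw [hA, hA, ← prod_range_mul_prod_Ico _ hkn, ← prod_range_mul_prod_Ico _ hkn, mul_right_comm,
    mul_right_comm (∏ i ∈ range k, ∏ j ∈ Ico (i + 1) n, (((k - 1 - i : ℕ) : K) - _ + j - i)),
    ← prod_mul_distrib, ← prod_mul_distrib]
  congr 1
  · refine prod_congr rfl fun i hi => ?_
    rw [mem_range] at hi
    rw [← prod_Ico_consecutive _ (show i + 1 ≤ k by omega) hkn,
      ← prod_Ico_consecutive _ (show i + 1 ≤ k by omega) hkn, mul_assoc, mul_assoc]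
    have key := prod_Ico_shift_mul (fun j : ℕ => (k : K) + j - 2 * i - 1) hkn
    have hi' : ((k - 1 - i : ℕ) : K) = (k : K) - 1 - i := by
      rw [Nat.cast_sub (by omega), Nat.cast_sub (by omega), Nat.cast_one]
    have hi'' : ((k + 1 - 1 - i : ℕ) : K) = (k : K) - i := by
      rw [Nat.add_sub_cancel, Nat.cast_sub (by omega)]
    congr 1
    · refine prod_congr rfl fun j hj => ?_
      rw [mem_Ico] at hj
      rw [hi', hi'', Nat.add_sub_cancel, Nat.cast_sub (by omega), Nat.cast_sub (by omega),
        Nat.cast_sub (by omega)]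
      push_cast
      ring
    · refine Eq.trans ?_ (key.trans ?_)
      · congr 1
        refine prod_congr rfl fun j hj => ?_
        rw [mem_Ico] at hj
        rw [hi'', show k + 1 - 1 - j = 0 by omega]
        push_cast
        ring
      · congr 1
        refine prod_congr rfl fun j hj => ?_
        rw [mem_Ico] at hj
        rw [hi', show k - 1 - j = 0 by omega]
        push_cast
        ring
  · refine prod_congr rfl fun i hi => prod_congr rfl fun j hj => ?_
    rw [mem_Ico] at hi hj
    rw [show k + 1 - 1 - i = k - 1 - i by omega, show k + 1 - 1 - j = k - 1 - j by omega]

/-- Read backwards, the product is `1 · 3 ⋯ (2k - 1)`, and `2 ^ k k!` supplies the even factors of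
`(2k)!`. -/
theorem prod_odd_mul (k : ℕ) :
    (∏ i ∈ range k, ((k : K) + k - 2 * i - 1)) * (2 ^ k * (k.factorial : K)) =
      ((2 * k).factorial : K) := by
  have h : ∏ i ∈ range k, ((k : K) + k - 2 * i - 1) = ∏ i ∈ range k, (2 * (i : K) + 1) := by
    rw [← prod_range_reflect]
    refine prod_congr rfl fun i hi => ?_
    rw [mem_range] at hi
    rw [Nat.cast_sub (by omega), Nat.cast_sub (by omega)]
    push_cast
    ring
  rw [h]
  clear h
  induction k with
  | zero => simp
  | succ k ih =>
    rw [prod_range_succ, show 2 * (k + 1) = 2 * k + 1 + 1 by ring, Nat.factorial_succ k,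
      Nat.factorial_succ (2 * k + 1), Nat.factorial_succ (2 * k), Nat.cast_mul, Nat.cast_mul, Nat.cast_mul, ← ih]
    push_cast
    ring

/-- At `z = -1` only the term `r = k` survives, so the first parameter `a` plays no role.
Multiplying each factor of the remaining binomial by `-2` and reversing their order gives the
product. -/
theorem jacobi_neg_one [CharZero K] (k : ℕ) (n a : K) :
    2 ^ k * (k.factorial : K) * jacobi k a ((-n - k - 1) / 2) (-1) =
      ∏ i ∈ range k, ((k : K) + n - 2 * i - 1) := by
  have hk : (k.factorial : K) ≠ 0 := Nat.cast_ne_zero.2 (Nat.factorial_ne_zero _)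
  rw [jacobi, sum_range_succ, sum_eq_zero, zero_add]
  · have h1 : ((-1 : K) - 1) / 2 = -1 := by norm_num
    simp only [Nat.sub_self, binom, range_zero, prod_empty, Nat.factorial_zero, Nat.cast_one,
      div_one, one_mul, pow_zero, mul_one, h1]
    have h2 : ∀ P : K, 2 ^ k * (k.factorial : K) * (P / (k.factorial : K) * (-1) ^ k) =
        (∏ _i ∈ range k, (-2 : K)) * P := fun P => by
      rw [prod_const, card_range, neg_pow (2 : K)]
      field_simp
    rw [h2, ← prod_range_reflect (fun i : ℕ => (k : K) + n - 2 * i - 1), ← prod_mul_distrib]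
    refine prod_congr rfl fun i hi => ?_
    rw [mem_range] at hi
    rw [Nat.cast_sub (by omega), Nat.cast_sub (by omega)]
    push_cast
    field_simp
    ring
  · intro r hr
    rw [mem_range] at hr
    rw [neg_add_cancel, zero_div, zero_pow (by omega), mul_zero]

theorem entrySets_nonempty {n : ℕ} {l : ℕ → ℕ} (hl : Antitone l) (h0 : l n = 0) :
    (entrySets n l).Nonempty := by
  have hn : ∀ {i j}, j < l i → i < n := fun {i j} h => by
    by_contra! hi
    have := hl hi
    omega
  -- The tableau with `{i}` in every box of row `i`.
  refine ⟨(range n).biUnion fun i => (range (l i)).image fun j => (i, j, i), ?_⟩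
  rw [mem_entrySets hl]
  have hmem : ∀ {i j m}, (i, j, m) ∈ ((range n).biUnion fun i =>
      (range (l i)).image fun j => (i, j, i)) ↔ j < l i ∧ m = i := by
    intro i j m
    simp only [mem_biUnion, mem_range, mem_image, Prod.mk.injEq]
    constructor
    · rintro ⟨i', _, j', h, rfl, rfl, rfl⟩
      exact ⟨h, rfl⟩
    · rintro ⟨h, rfl⟩
      exact ⟨m, hn h, j, h, rfl, rfl, rfl⟩
  refine ⟨fun h => ?_, fun h => ?_, fun h => ?_, fun h h' => ?_, fun h h' => ?_⟩
  · obtain ⟨h, rfl⟩ := hmem.1 h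
    exact hn h
  · exact (hmem.1 h).1
  · exact ⟨_, hmem.2 ⟨h, rfl⟩⟩
  · rw [(hmem.1 h).2, (hmem.1 h').2]
  · rw [(hmem.1 h).2, (hmem.1 h').2]
    exact Nat.lt_succ_self _

-- As a polynomial in `β` the sum has rational coefficients, and its value at `β = 1` is the number
-- of tableaux, which is positive; a transcendental element is not a root.
open Polynomial in
theorem grothendieckOnes_ne_zero_of_transcendental [CharZero K] {β : K} (hβ : Transcendental ℚ β)
    {n : ℕ} {l : ℕ → ℕ} (hl : Antitone l) (h0 : l n = 0) : grothendieckOnes β n l ≠ 0 := by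
  intro h
  have h1 : grothendieckOnes (X : ℚ[X]) n l = 0 := by
    refine transcendental_iff.1 hβ _ ?_
    have := map_grothendieckOnes (aeval β : ℚ[X] →ₐ[ℚ] K).toRingHom X n l
    simp only [AlgHom.toRingHom_eq_coe, RingHom.coe_coe, aeval_X] at this
    rw [this, h]
  have h2 := map_grothendieckOnes (evalRingHom (1 : ℚ)) X n l
  rw [h1, map_zero, coe_evalRingHom, eval_X] at h2
  simp only [grothendieckOnes, one_pow, sum_const, nsmul_eq_mul, mul_one] at h2
  have := Nat.cast_eq_zero.1 h2.symm
  exact (entrySets_nonempty hl h0).ne_empty (card_eq_zero.1 this)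

end Staircase

end StaircaseGrothendieck

open StaircaseGrothendieck in
/-- `β` is any element of any field of characteristic zero. A complex value is the case `K = ℂ`;
the formal parameter is the case of the rational function field with `β` the indeterminate, which
is transcendental (with, say, the discrete topology: the series have finitely many nonzero
terms, so that their sums do not depend on the topology). -/
theorem proposition4p4 {K : Type*} [Field K] [CharZero K] [TopologicalSpace K] [T2Space K]
    (k n : ℕ) (hk : 1 ≤ k) (hkn : k ≤ n) (β : K) :
    (Function.support (holmanShapeTerm n (staircase k) (-β))).Finite ∧
    (Function.support (holmanShapeTerm n (staircase (k + 1)) (-β))).Finite ∧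
    (Transcendental ℚ β → grothendieck (staircase k) (fun _ : Fin n => (1 : K)) β ≠ 0) ∧
    (grothendieck (staircase k) (fun _ : Fin n => (1 : K)) β ≠ 0 →
      holmanShape n (staircase k) (-β) ≠ 0 ∧
      grothendieck (staircase (k + 1)) (fun _ : Fin n => (1 : K)) β /
          grothendieck (staircase k) (fun _ : Fin n => (1 : K)) β =
        (2 ^ (2 * k) * (k.factorial : K) ^ 2 / ((2 * k).factorial : K)) *
          jacobi k (((n : K) - k - 1) / 2) ((-(n : K) - k - 1) / 2) (-1) *
          (holmanShape n (staircase (k + 1)) (-β) / holmanShape n (staircase k) (-β))) := by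
  have hrow : (staircase k).rowLen n = 0 := by rw [rowLen_staircase]; omega
  have hrow' : (staircase (k + 1)).rowLen n = 0 := by rw [rowLen_staircase]; omega
  refine ⟨finite_support_holmanShapeTerm n _ β, finite_support_holmanShapeTerm n _ β,
    fun hβ => ?_, fun hG => ?_⟩
  · rw [grothendieck_one β _ hrow]
    exact grothendieckOnes_ne_zero_of_transcendental hβ
      (fun a b h => (staircase k).rowLen_anti a b h) hrow
  have h1 := factorial_mul_grothendieck n _ hrow β
  have h2 := factorial_mul_grothendieck n _ hrow' β
  have hV := prodA_ne_zero (K := K) n (staircase k)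
  have hsf : (∏ i : Fin n, ((i : ℕ).factorial : K)) ≠ 0 :=
    Finset.prod_ne_zero_iff.2 fun i _ => Nat.cast_ne_zero.2 (Nat.factorial_ne_zero _)
  have hF : holmanShape n (staircase k) (-β) ≠ 0 := by
    intro h
    rw [h, mul_zero] at h1
    exact mul_ne_zero hsf hG h1
  refine ⟨hF, ?_⟩
  have h3 := prodA_staircase_succ (K := K) hkn
  have h4 := prod_odd_mul (K := K) k
  have h5 := jacobi_neg_one k (n : K) (((n : K) - k - 1) / 2)
  have hfac : ((2 * k).factorial : K) ≠ 0 := Nat.cast_ne_zero.2 (Nat.factorial_ne_zero _)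
  rw [← h5] at h3
  generalize jacobi k (((n : K) - k - 1) / 2) ((-(n : K) - k - 1) / 2) (-1) = J at *
  rw [← h4] at hfac ⊢
  generalize ∏ i ∈ Finset.range k, ((k : K) + k - 2 * i - 1) = O at *
  have hO : O ≠ 0 := left_ne_zero_of_mul hfac
  have hk0 : (k.factorial : K) ≠ 0 := Nat.cast_ne_zero.2 (Nat.factorial_ne_zero _)
  -- The whole prefactor is the quotient of the two products of the `A_ij`; here `O (2 ^ k k!)`
  -- stands for `(2k)!`.
  have hJ : 2 ^ (2 * k) * (k.factorial : K) ^ 2 / (O * (2 ^ k * (k.factorial : K))) * J =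
      prodA K n (staircase (k + 1)) / prodA K n (staircase k) := by
    rw [div_mul_eq_mul_div, div_eq_div_iff hfac hV]
    linear_combination -(2 ^ k * (k.factorial : K)) * h3
  rw [hJ, div_mul_div_comm, ← h1, ← h2, mul_div_mul_left _ _ hsf]
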